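/- Let $\Omega$ be a topological space, $\emptyset\ne S\subset\Omega$, and let $X$ be a (real or complex) locally convex topological vector space with topological dual $X^*$ (no Hausdorff assumption is made on $\Omega$ or $X$). Let $f\in C(S,X)$, i.e. $f:S\to X$ is continuous for the subspace topology on $S$. Suppose that $\overline{f(S)}$ is compact and that the closure in $X$ of the linear span of $f(S)$ is metrizable and complete. Then the following are equivalent. (i) $C(\Omega,[0,1])$ separates disjoint Lebesgue sets of $f$ in $S$; that is, for every $e^*\in X^*$ and all real numbers $a<b$ there is a continuous $\varphi:\Omega\to[0,1]$ such that $\overline{\varphi(L_a)}\cap\overline{\varphi(L^b)}=\emptyset$, where \[ L_a=\{x\in S:\operatorname{Re} e^*(f(x))\le a\},\qquad L^b=\{x\in S:\operatorname{Re} e^*(f(x))\ge b\} \] (with $\varphi(\emptyset)=\overline{\emptyset}=\emptyset$). (ii) There is $g\in C(\Omega,X)$ such that $g|_S=f$, $g(\Omega)$ is contained in the convex hull of $\overline{f(S)}$, and $\overline{g(\Omega)}$ is compact. -/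

import Mathlib

/-- The set of all continuous functions from `Ω` into `[0, 1]`, regarded as a subset of
`C(Ω, ℂ)`. -/
def unitIntervalFunctions (Ω : Type*) [TopologicalSpace Ω] : Set C(Ω, ℂ) :=
  {φ | ∀ x, ∃ t ∈ Set.Icc (0 : ℝ) 1, φ x = (t : ℂ)}

section LebesgueSets

variable {𝕜 Ω X : Type*} [RCLike 𝕜] [AddCommGroup X] [Module 𝕜 X] [TopologicalSpace X]

/-- The lower Lebesgue set `L_a = {x ∈ S : Re e(f(x)) ≤ a}` of `e ∘ f` in `S`, as a subset
of `Ω`. -/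
def lowerLebesgueSet {S : Set Ω} (f : S → X) (e : X →L[𝕜] 𝕜) (a : ℝ) : Set Ω :=
  {x | ∃ hx : x ∈ S, RCLike.re (e (f ⟨x, hx⟩)) ≤ a}

/-- The upper Lebesgue set `L^b = {x ∈ S : Re e(f(x)) ≥ b}` of `e ∘ f` in `S`, as a subset
of `Ω`. -/
def upperLebesgueSet {S : Set Ω} (f : S → X) (e : X →L[𝕜] 𝕜) (b : ℝ) : Set Ω :=
  {x | ∃ hx : x ∈ S, b ≤ RCLike.re (e (f ⟨x, hx⟩))}

variable (𝕜) in
/-- `A ⊆ C(Ω, ℂ)` separates disjoint Lebesgue sets of `f : S → X` in `S ⊆ Ω`: for every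
continuous linear functional `e` on `X` and all reals `a < b` there is `φ ∈ A` such that
`φ(L_a)` and `φ(L^b)` have disjoint closures. -/
def SeparatesDisjointLebesgueSets [TopologicalSpace Ω] (A : Set C(Ω, ℂ)) {S : Set Ω}
    (f : S → X) : Prop :=
  ∀ (e : X →L[𝕜] 𝕜) (a b : ℝ), a < b → ∃ φ ∈ A,
    closure (φ '' lowerLebesgueSet f e a) ∩ closure (φ '' upperLebesgueSet f e b) = ∅

end LebesgueSets

/-! For (i) ⇒ (ii), let `K` be the closure of `f(S)` and gather all separating functions into one
map `Φ` from `Ω` to a compact product `Q` of discs. By Hahn–Banach, distinct points of `K` have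
neighbourhoods whose preimages under `f` have `Φ`-images with disjoint closures. Hence the closure
of the graph {(Φ s, f s)} in `Q × K` projects injectively to `Q`, so `f` is a continuous function of
`Φ` on a closed subset of `Q`. With `K` embedded in `ℕ → ℝ`, Tietze extends this function to `Q`;
Dugundji's theorem then maps `ℕ → ℝ` into the convex hull of `K`, fixing `K`. The converse truncates
Re e∘g. -/

open Set Topology in
/-- **Dugundji extension theorem**: a continuous map from a closed subspace of a metric space to a
locally convex space extends to the whole space, with values in the convex hull of its range. -/
theorem Topology.IsClosedEmbedding.exists_extension_mem_convexHull {K M X : Type*}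
    [TopologicalSpace K] [Nonempty K] [MetricSpace M] [AddCommGroup X] [Module ℝ X]
    [TopologicalSpace X] [IsTopologicalAddGroup X] [ContinuousSMul ℝ X] [LocallyConvexSpace ℝ X]
    {κ : K → M} (hκ : IsClosedEmbedding κ) (j : C(K, X)) :
    ∃ h : C(M, X), (∀ k, h (κ k) = j k) ∧ ∀ x, h x ∈ convexHull ℝ (range j) := by
  classical
  have hne : (range κ).Nonempty := range_nonempty κ
  let A : Set M := range κ
  have hA : IsClosed A := hκ.isClosed_range
  -- Any factor above 1 makes these sets nonempty off `A`, while the points used remain close to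
  -- `x`.
  let t : M → Set X := fun x => convexHull ℝ (j '' {k | dist x (κ k) < 2 * Metric.infDist x A})
  have hcont (k : K) : IsOpen {y : M | dist y (κ k) < 2 * Metric.infDist y A} :=
    isOpen_lt (by fun_prop) (continuous_const.mul (Metric.continuous_infDist_pt A))
  obtain ⟨h₀, hh₀⟩ : ∃ h₀ : C((Aᶜ : Set M), X), ∀ x : (Aᶜ : Set M), h₀ x ∈ t x := by
    refine exists_continuous_forall_mem_convex_of_local_const (t := fun x : (Aᶜ : Set M) => t x)
      (fun x => convex_convexHull ℝ _) fun x => ?_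
    have hpos : 0 < Metric.infDist (x : M) A := (hA.notMem_iff_infDist_pos hne).1 x.2
    obtain ⟨_, ⟨k, rfl⟩, hk⟩ :=
      (Metric.infDist_lt_iff (r := 2 * Metric.infDist (x : M) A) hne).1 (by linarith)
    refine ⟨j k, ?_⟩
    filter_upwards [((hcont k).preimage continuous_subtype_val).mem_nhds hk] with y hy
    exact subset_convexHull ℝ _ ⟨k, hy, rfl⟩
  let h : M → X := fun x => if hx : x ∈ A then j hx.choose else h₀ ⟨x, hx⟩
  have hval (k : K) : h (κ k) = j k := by
    have hk : κ k ∈ A := mem_range_self k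
    simp only [h, dif_pos hk]
    exact congrArg j (hκ.injective hk.choose_spec)
  have hoff (x : M) (hx : x ∉ A) : h x = h₀ ⟨x, hx⟩ := dif_neg hx
  refine ⟨⟨h, continuous_iff_continuousAt.2 fun x => ?_⟩, hval, fun x => ?_⟩
  · by_cases hx : x ∈ A
    · obtain ⟨k, rfl⟩ := hx
      rw [ContinuousAt, hval, (LocallyConvexSpace.convex_basis (𝕜 := ℝ) (j k)).tendsto_right_iff]
      rintro W ⟨hW, hWc⟩
      have hjW : j ⁻¹' W ∈ 𝓝 k := j.continuous.continuousAt hW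
      rw [hκ.isInducing.nhds_eq_comap, Metric.nhds_basis_ball.comap κ |>.mem_iff] at hjW
      obtain ⟨δ, hδ, hδW⟩ := hjW
      -- dist(κ l, κ k) < 2 infDist(y, A) + dist(y, κ k) ≤ 3 dist(y, κ k), hence δ/3.
      filter_upwards [Metric.ball_mem_nhds (κ k) (show 0 < δ / 3 by positivity)] with y hy
      rw [Metric.mem_ball] at hy
      by_cases hyA : y ∈ A
      · obtain ⟨l, rfl⟩ := hyA
        rw [id, hval]
        exact hδW (by rw [mem_preimage, Metric.mem_ball]; linarith)
      · rw [id, hoff y hyA]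
        refine convexHull_min ?_ hWc (hh₀ ⟨y, hyA⟩)
        rintro _ ⟨l, hl, rfl⟩
        have hl : dist y (κ l) < 2 * Metric.infDist y A := hl
        refine hδW ?_
        rw [mem_preimage, Metric.mem_ball]
        have h1 : Metric.infDist y A ≤ dist y (κ k) :=
          Metric.infDist_le_dist_of_mem (mem_range_self k)
        have h2 := dist_triangle_left (κ l) (κ k) y
        linarith
    · have hc : ContinuousOn h Aᶜ := by
        rw [continuousOn_iff_continuous_domRestrict]
        convert h₀.continuous using 1
        ext y
        exact hoff y y.2
      exact hc.continuousAt (hA.isOpen_compl.mem_nhds hx)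
  · by_cases hx : x ∈ A
    · obtain ⟨k, rfl⟩ := hx
      exact subset_convexHull ℝ _ ⟨k, (hval k).symm⟩
    · change h x ∈ _
      rw [hoff x hx]
      exact convexHull_mono (image_subset_range _ _) (hh₀ ⟨x, hx⟩)

open Set Topology in
/-- A map `f` from a set `S` to a compact Hausdorff space can be composed with a continuous map
`E` to `ι → ℝ` so that the composition extends continuously to the whole space,
provided that some `Φ` to a compact Hausdorff space separates the preimages under `f` of suitable
neighbourhoods of any two distinct points. -/
theorem ContinuousMap.exists_extension_comp_of_separates {Ω Q K ι : Type*} [TopologicalSpace Ω]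
    [TopologicalSpace Q] [CompactSpace Q] [T2Space Q] [TopologicalSpace K] [CompactSpace K]
    {S : Set Ω} (f : S → K) (Φ : C(Ω, Q)) (E : C(K, ι → ℝ))
    (hsep : ∀ k l : K, k ≠ l → ∃ U ∈ 𝓝 k, ∃ V ∈ 𝓝 l,
      Disjoint (closure ((fun s : S => Φ s) '' (f ⁻¹' U)))
        (closure ((fun s : S => Φ s) '' (f ⁻¹' V)))) :
    ∃ v : C(Ω, ι → ℝ), ∀ s : S, v s = E (f s) := by
  let G : Set (Q × K) := closure (range fun s : S => (Φ s, f s))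
  have key {q : Q} {k : K} (hG : (q, k) ∈ G) {U : Set K} (hU : U ∈ 𝓝 k) :
      q ∈ closure ((fun s : S => Φ s) '' (f ⁻¹' U)) := by
    rw [mem_closure_iff_nhds] at hG ⊢
    intro N hN
    obtain ⟨_, ⟨h1, h2⟩, s, rfl⟩ := hG _ (prod_mem_nhds hN hU)
    exact ⟨Φ s, h1, s, h2, rfl⟩
  have hinj : Function.Injective fun z : G => z.1.1 := by
    rintro ⟨⟨q, k⟩, hk⟩ ⟨⟨q', l⟩, hl⟩ (rfl : q = q')
    by_cases hkl : k = l
    · subst hkl; rfl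
    · obtain ⟨U, hU, V, hV, hd⟩ := hsep k l hkl
      exact (disjoint_left.1 hd (key hk hU) (key hl hV)).elim
  have : CompactSpace G := isCompact_iff_compactSpace.1 isClosed_closure.isCompact
  have he : IsClosedEmbedding fun z : G => z.1.1 :=
    Continuous.isClosedEmbedding (by fun_prop) hinj
  obtain ⟨w, hw⟩ := ContinuousMap.exists_extension' he
    (⟨fun z : G => E z.1.2, by fun_prop⟩ : C(G, ι → ℝ))
  exact ⟨w.comp Φ, fun s => congrFun hw ⟨(Φ s, f s), subset_closure ⟨s, rfl⟩⟩⟩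

open Set Topology in
/-- A compact metrizable space embeds as a closed subspace of `ℕ → ℝ`. -/
theorem exists_isClosedEmbedding_nat_real (K : Type*) [TopologicalSpace K] [CompactSpace K]
    [TopologicalSpace.MetrizableSpace K] [Nonempty K] :
    ∃ E : C(K, ℕ → ℝ), IsClosedEmbedding E := by
  let := TopologicalSpace.metrizableSpaceMetric K
  let u := TopologicalSpace.denseSeq K
  refine ⟨⟨fun k n => dist k (u n), by fun_prop⟩,
    Continuous.isClosedEmbedding (by fun_prop) fun k l hkl => ?_⟩
  have hkl : (fun x => dist k x) = fun x => dist l x :=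
    (TopologicalSpace.denseRange_denseSeq K).equalizer (by fun_prop) (by fun_prop) hkl
  exact (dist_eq_zero.1 ((congrFun hkl k).symm.trans (dist_self k))).symm

/-- A topological group is Hausdorff if a closed subset containing `0` is. -/
theorem IsClosed.t2Space_of_zero_mem {X : Type*} [AddGroup X] [TopologicalSpace X]
    [IsTopologicalAddGroup X] {Y : Set X} (hY : IsClosed Y) [T1Space Y] (h0 : (0 : X) ∈ Y) :
    T2Space X := by
  have h : IsClosed ({0} : Set X) := by
    simpa using hY.isClosedEmbedding_subtypeVal.isClosedMap _ (isClosed_singleton (x := ⟨0, h0⟩))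
  have := IsTopologicalAddGroup.t1Space X h
  infer_instance

open Set in
/-- A continuous map on the whole space separates the disjoint Lebesgue sets of its restriction. -/
theorem separatesDisjointLebesgueSets_of_extension {𝕜 Ω X : Type*} [RCLike 𝕜]
    [TopologicalSpace Ω] [AddCommGroup X] [Module 𝕜 X] [TopologicalSpace X] {S : Set Ω}
    {f : S → X} (g : C(Ω, X)) (hg : ∀ x : S, g x = f x) :
    SeparatesDisjointLebesgueSets 𝕜 (unitIntervalFunctions Ω) f := by
  intro e a b hab
  have hab' : 0 < b - a := sub_pos.2 hab
  -- The affine map sending a to 0 and b to 1, clamped to [0, 1]: `r` is 0 on the lower set and 1 on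
  -- the upper one.
  let r : Ω → ℝ := fun x => projIcc (0 : ℝ) 1 zero_le_one ((RCLike.re (e (g x)) - a) / (b - a))
  have hr : Continuous r := by
    have : Continuous fun x => (RCLike.re (e (g x)) - a) / (b - a) :=
      ((RCLike.continuous_re.comp (e.continuous.comp g.continuous)).sub
        continuous_const).div_const _
    exact continuous_subtype_val.comp (continuous_projIcc.comp this)
  refine ⟨⟨fun x => (r x : ℂ), Complex.continuous_ofReal.comp hr⟩,
    fun x => ⟨r x, Subtype.prop _, rfl⟩, ?_⟩
  rw [← disjoint_iff_inter_eq_empty]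
  refine Disjoint.mono (closure_minimal (t := {0}) ?_ isClosed_singleton)
    (closure_minimal (t := {1}) ?_ isClosed_singleton) (by simp)
  · rintro _ ⟨x, ⟨hx, hle⟩, rfl⟩
    have : r x = 0 := by
      simp only [r]
      rw [projIcc_of_le_left]
      exact div_nonpos_of_nonpos_of_nonneg (by rw [hg ⟨x, hx⟩]; linarith) hab'.le
    simp [this]
  · rintro _ ⟨x, ⟨hx, hle⟩, rfl⟩
    have : r x = 1 := by
      simp only [r]
      rw [projIcc_of_right_le]
      rw [one_le_div hab', hg ⟨x, hx⟩]
      linarith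
    simp [this]

open Set Topology in
/-- If the unit interval functions separate the disjoint Lebesgue sets of a map `f` into a set
`K`, then a single map to a compact Hausdorff space separates suitable neighbourhoods of any two
distinct points of `K`. -/
theorem SeparatesDisjointLebesgueSets.exists_separating_map {𝕜 Ω X : Type*} [RCLike 𝕜]
    [TopologicalSpace Ω] [AddCommGroup X] [Module 𝕜 X] [Module ℝ X] [IsScalarTower ℝ 𝕜 X]
    [TopologicalSpace X] [IsTopologicalAddGroup X] [ContinuousSMul 𝕜 X] [LocallyConvexSpace ℝ X]
    [T1Space X] {S : Set Ω} {K : Set X} (f : S → K)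
    (h : SeparatesDisjointLebesgueSets 𝕜 (unitIntervalFunctions Ω) fun s => (f s : X)) :
    ∃ Φ : C(Ω, (X →L[𝕜] 𝕜) × {p : ℝ × ℝ // p.1 < p.2} → Metric.closedBall (0 : ℂ) 1),
      ∀ k l : K, k ≠ l → ∃ U ∈ 𝓝 k, ∃ V ∈ 𝓝 l,
        Disjoint (closure ((fun s : S => Φ s) '' (f ⁻¹' U)))
          (closure ((fun s : S => Φ s) '' (f ⁻¹' V))) := by
  choose φ hφ hd using fun i : (X →L[𝕜] 𝕜) × {p : ℝ × ℝ // p.1 < p.2} =>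
    h i.1 i.2.1.1 i.2.1.2 i.2.2
  have hball (i) (x : Ω) : φ i x ∈ Metric.closedBall (0 : ℂ) 1 := by
    obtain ⟨t, ht, hx⟩ := hφ i x
    rw [hx, mem_closedBall_zero_iff, Complex.norm_real, Real.norm_of_nonneg ht.1]
    exact ht.2
  refine ⟨⟨fun x i => ⟨φ i x, hball i x⟩, by fun_prop⟩, fun k l hkl => ?_⟩
  obtain ⟨e, he⟩ := RCLike.geometric_hahn_banach_point_point (𝕜 := 𝕜)
    (Subtype.coe_injective.ne hkl)
  -- Two intermediate levels leave a gap, so the open half-spaces around `k` and `l` pull back into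
  -- disjoint Lebesgue sets.
  obtain ⟨a, hka, hal⟩ := exists_between he
  obtain ⟨b, hab, hbl⟩ := exists_between hal
  have hc : Continuous fun y : K => RCLike.re (e y) :=
    RCLike.continuous_re.comp (e.continuous.comp continuous_subtype_val)
  refine ⟨{y | RCLike.re (e y) < a}, (isOpen_lt hc continuous_const).mem_nhds hka,
    {y | b < RCLike.re (e y)}, (isOpen_lt continuous_const hc).mem_nhds hbl, ?_⟩
  let i : (X →L[𝕜] 𝕜) × {p : ℝ × ℝ // p.1 < p.2} := (e, ⟨(a, b), hab⟩)
  rw [disjoint_left]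
  intro q hq hq'
  -- Disjointness in the product can be tested on the single coordinate `i`.
  have hev : Continuous fun q : (X →L[𝕜] 𝕜) × {p : ℝ × ℝ // p.1 < p.2} →
      Metric.closedBall (0 : ℂ) 1 => (q i : ℂ) := by fun_prop
  refine eq_empty_iff_forall_notMem.1 (hd i) (q i : ℂ) ⟨?_, ?_⟩
  · refine closure_mono ?_ (image_closure_subset_closure_image hev (mem_image_of_mem _ hq))
    rintro _ ⟨_, ⟨s, hs, rfl⟩, rfl⟩
    exact ⟨s, ⟨s.2, le_of_lt hs⟩, rfl⟩
  · refine closure_mono ?_ (image_closure_subset_closure_image hev (mem_image_of_mem _ hq'))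
    rintro _ ⟨_, ⟨s, hs, rfl⟩, rfl⟩
    exact ⟨s, ⟨s.2, le_of_lt hs⟩, rfl⟩

/-- A subset of the convex hull of a compact set is relatively compact if the hull is contained in
a closed complete set. -/
theorem IsCompact.isCompact_closure_of_subset_convexHull {X : Type*} [AddCommGroup X] [Module ℝ X]
    [UniformSpace X] [IsUniformAddGroup X] [ContinuousSMul ℝ X] [LocallyConvexSpace ℝ X]
    {K Y T : Set X} (hK : IsCompact K) (hY : IsClosed Y) (hYc : IsComplete Y)
    (hKY : convexHull ℝ K ⊆ Y) (hT : T ⊆ convexHull ℝ K) : IsCompact (closure T) := by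
  refine isCompact_iff_totallyBounded_isComplete.2
    ⟨(hK.totallyBounded.convexHull.subset hT).closure, ?_⟩
  have hsub : closure T ⊆ Y := closure_minimal (hT.trans hKY) hY
  intro F hF hFT
  obtain ⟨y, -, hy⟩ := hYc F hF (hFT.trans (Filter.principal_mono.2 hsub))
  have := hF.1
  exact ⟨y, isClosed_closure.mem_of_tendsto (b := F) (f := id) hy
    (Filter.le_principal_iff.1 hFT), hy⟩

theorem mainTheorem5 {𝕜 Ω X : Type*} [RCLike 𝕜] [TopologicalSpace Ω]
    [AddCommGroup X] [Module 𝕜 X] [Module ℝ X] [IsScalarTower ℝ 𝕜 X]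
    [UniformSpace X] [IsUniformAddGroup X] [ContinuousSMul 𝕜 X] [LocallyConvexSpace ℝ X]
    (S : Set Ω) (hS : S.Nonempty) (f : C(S, X))
    (hmetr : TopologicalSpace.MetrizableSpace
      (closure (Submodule.span 𝕜 (Set.range f) : Set X)))
    (hcompl : IsComplete (closure (Submodule.span 𝕜 (Set.range f) : Set X)))
    (hcomp : IsCompact (closure (Set.range f))) :
    SeparatesDisjointLebesgueSets 𝕜 (unitIntervalFunctions Ω) f ↔
      ∃ g : C(Ω, X), (∀ x : S, g x = f x) ∧
        Set.range g ⊆ convexHull ℝ (closure (Set.range f)) ∧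
        IsCompact (closure (Set.range g)) := by

  have : ContinuousSMul ℝ X := IsScalarTower.continuousSMul 𝕜
  let P := Submodule.span 𝕜 (Set.range f)
  have hYcl : IsClosed (closure (P : Set X)) := isClosed_closure
  have hKY : closure (Set.range f) ⊆ closure (P : Set X) := closure_mono Submodule.subset_span
  have : T2Space X := hYcl.t2Space_of_zero_mem (subset_closure P.zero_mem)
  refine ⟨fun h => ?_, fun ⟨g, hg, _⟩ => separatesDisjointLebesgueSets_of_extension g hg⟩
  have hconv : convexHull ℝ (closure (Set.range f)) ⊆ closure (P : Set X) :=
    convexHull_min hKY (P.restrictScalars ℝ).convex.closure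
  have : CompactSpace (closure (Set.range f)) := isCompact_iff_compactSpace.1 hcomp
  have : TopologicalSpace.MetrizableSpace (closure (Set.range f)) :=
    (Topology.IsEmbedding.inclusion hKY).metrizableSpace
  have : Nonempty S := hS.to_subtype
  let f' : S → closure (Set.range f) := fun s => ⟨f s, subset_closure ⟨s, rfl⟩⟩
  have : Nonempty (closure (Set.range f)) := this.map f'
  obtain ⟨Φ, hΦ⟩ := SeparatesDisjointLebesgueSets.exists_separating_map f' h
  obtain ⟨E, hE⟩ := exists_isClosedEmbedding_nat_real (closure (Set.range f))
  obtain ⟨v, hv⟩ := ContinuousMap.exists_extension_comp_of_separates f' Φ E hΦ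
  -- Dugundji needs a metric on the target of `E`; countably many coordinates, available because `K`
  -- is metrizable, ensure one.
  let := TopologicalSpace.metrizableSpaceMetric (ℕ → ℝ)
  obtain ⟨d, hdE, hd⟩ := hE.exists_extension_mem_convexHull
    (⟨Subtype.val, continuous_subtype_val⟩ : C(closure (Set.range f), X))
  have hrange : Set.range (d.comp v) ⊆ convexHull ℝ (closure (Set.range f)) := by
    rintro _ ⟨x, rfl⟩
    simpa using hd (v x)
  refine ⟨d.comp v, fun x => ?_, hrange,
    hcomp.isCompact_closure_of_subset_convexHull hYcl hcompl hconv hrange⟩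
  rw [ContinuousMap.comp_apply, hv, hdE]
  rfl
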